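/- Let $\mathrm{Sol}$ be the Lie group $\mathbb{R}^2\rtimes\mathbb{R}$ with multiplication $$(x_1,y_1,z_1)(x_2,y_2,z_2)=(x_1+e^{z_1}x_2,\;y_1+e^{-z_1}y_2,\;z_1+z_2),$$ and for $A\in\mathrm{SL}_2(\mathbb{Z})$ let $\mathbb{Z}^2\rtimes_A\mathbb{Z}$ be the semidirect product with multiplication $(v_1,r_1)(v_2,r_2)=(v_1+A^{r_1}v_2,\;r_1+r_2)$. A lattice in $\mathrm{Sol}$ is a discrete subgroup $\Gamma$ such that $\mathrm{Sol}/\Gamma$ carries a nonzero finite $\mathrm{Sol}$-invariant Borel measure. Every lattice $\Gamma$ of $\mathrm{Sol}$ is conjugate in $\mathrm{Sol}$ to a semidirect product lattice. That is, there are a matrix $A\in\mathrm{SL}_2(\mathbb{Z})$, a real number $s\neq 0$, a matrix $P\in\mathrm{GL}_2(\mathbb{R})$ with $$PAP^{-1}=\begin{pmatrix}e^{s}&0\\0&e^{-s}\end{pmatrix},$$ and an element $g\in\mathrm{Sol}$ such that the map $\mathbb{Z}^2\rtimes_A\mathbb{Z}\to\mathrm{Sol}$, $(p,q,r)\mapsto(P(p,q),\,sr)$,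 is an injective group homomorphism whose image $\Gamma_0$ is a lattice of $\mathrm{Sol}$, and $g\,\Gamma_0\,g^{-1}=\Gamma$. -/

import Mathlib

open MeasureTheory
open scoped Matrix MatrixGroups

/-- The underlying set `ℝ² × ℝ` of the group Sol. -/
@[ext]
structure Sol : Type where
  x : ℝ
  y : ℝ
  z : ℝ

namespace Sol

/-- Coordinates on Sol. -/
def equivProd : Sol ≃ ℝ × ℝ × ℝ where
  toFun g := (g.x, g.y, g.z)
  invFun p := ⟨p.1, p.2.1, p.2.2⟩
  left_inv _ := rfl
  right_inv _ := rfl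

/-- The multiplication of `ℝ² ⋊ ℝ`, where `z` acts on `ℝ²` as `diag (e^z, e^{-z})`. -/
noncomputable instance : Mul Sol :=
  ⟨fun g h => ⟨g.x + Real.exp g.z * h.x, g.y + Real.exp (-g.z) * h.y, g.z + h.z⟩⟩

instance : One Sol := ⟨⟨0, 0, 0⟩⟩

noncomputable instance : Inv Sol :=
  ⟨fun g => ⟨-(Real.exp (-g.z) * g.x), -(Real.exp g.z * g.y), -g.z⟩⟩

@[simp] theorem mul_x (g h : Sol) : (g * h).x = g.x + Real.exp g.z * h.x := rfl
@[simp] theorem mul_y (g h : Sol) : (g * h).y = g.y + Real.exp (-g.z) * h.y := rfl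
@[simp] theorem mul_z (g h : Sol) : (g * h).z = g.z + h.z := rfl
@[simp] theorem one_x : (1 : Sol).x = 0 := rfl
@[simp] theorem one_y : (1 : Sol).y = 0 := rfl
@[simp] theorem one_z : (1 : Sol).z = 0 := rfl
@[simp] theorem inv_x (g : Sol) : (g⁻¹).x = -(Real.exp (-g.z) * g.x) := rfl
@[simp] theorem inv_y (g : Sol) : (g⁻¹).y = -(Real.exp g.z * g.y) := rfl
@[simp] theorem inv_z (g : Sol) : (g⁻¹).z = -g.z := rfl

noncomputable instance : Group Sol :=
  Group.ofLeftAxioms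
    (by
      intro a b c
      ext
      · simp [Real.exp_add]; ring
      · simp [Real.exp_add, add_comm (-b.z)]; ring
      · simp [add_assoc])
    (by intro a; ext <;> simp)
    (by intro a; ext <;> simp)

/-- The topology of `ℝ³`. -/
instance : TopologicalSpace Sol := TopologicalSpace.induced equivProd inferInstance

/-- The coordinates are a homeomorphism onto `ℝ³`. -/
def homeomorphProd : Sol ≃ₜ ℝ × ℝ × ℝ := equivProd.toHomeomorphOfIsInducing ⟨rfl⟩

theorem continuous_x : Continuous Sol.x := continuous_fst.comp homeomorphProd.continuous

theorem continuous_y : Continuous Sol.y :=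
  (continuous_fst.comp continuous_snd).comp homeomorphProd.continuous

theorem continuous_z : Continuous Sol.z :=
  (continuous_snd.comp continuous_snd).comp homeomorphProd.continuous

theorem continuous_mk {X : Type*} [TopologicalSpace X] {a b c : X → ℝ}
    (ha : Continuous a) (hb : Continuous b) (hc : Continuous c) :
    Continuous fun t => (⟨a t, b t, c t⟩ : Sol) :=
  homeomorphProd.symm.continuous.comp (ha.prodMk (hb.prodMk hc))

instance : IsTopologicalGroup Sol where
  continuous_mul := by
    have h1 : Continuous fun p : Sol × Sol => p.1 := continuous_fst
    have h2 : Continuous fun p : Sol × Sol => p.2 := continuous_snd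
    exact continuous_mk
      ((continuous_x.comp h1).add
        ((Real.continuous_exp.comp (continuous_z.comp h1)).mul (continuous_x.comp h2)))
      ((continuous_y.comp h1).add
        ((Real.continuous_exp.comp (continuous_z.comp h1).neg).mul (continuous_y.comp h2)))
      ((continuous_z.comp h1).add (continuous_z.comp h2))
  continuous_inv :=
    continuous_mk
      ((Real.continuous_exp.comp continuous_z.neg).mul continuous_x).neg
      ((Real.continuous_exp.comp continuous_z).mul continuous_y).neg
      continuous_z.neg

/-- The Borel σ-algebra. -/
instance : MeasurableSpace Sol := borel Sol

instance : BorelSpace Sol := ⟨rfl⟩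

end Sol

/-- A lattice in a topological group `G` (with its Borel σ-algebra): a discrete subgroup `Γ` such
that `G ⧸ Γ` carries a nonzero finite `G`-invariant measure. The σ-algebra on `G ⧸ Γ` consists of
the sets with Borel preimage in `G`; for discrete `Γ` in a Lie group `G` this is the Borel
σ-algebra of the quotient topology. -/
structure IsLattice {G : Type*} [Group G] [TopologicalSpace G] [MeasurableSpace G]
    (Γ : Subgroup G) : Prop where
  discrete : DiscreteTopology Γ
  finite_covolume : ∃ μ : Measure (G ⧸ Γ),
    μ ≠ 0 ∧ IsFiniteMeasure μ ∧ SMulInvariantMeasure G (G ⧸ Γ) μ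

/-- The action of `ℤ` on `ℤ²` in which `r` acts as `A ^ r`, written multiplicatively. -/
noncomputable def powAction (A : SL(2, ℤ)) :
    Multiplicative ℤ →* MulAut (Multiplicative (Fin 2 → ℤ)) :=
  zpowersHom _ (AddEquiv.toMultiplicative (Matrix.SpecialLinearGroup.toLin' A).toAddEquiv)

theorem powAction_apply (A : SL(2, ℤ)) (r : Multiplicative ℤ)
    (v : Multiplicative (Fin 2 → ℤ)) :
    (powAction A r v).toAdd = ((A ^ r.toAdd : SL(2, ℤ)) : Matrix (Fin 2) (Fin 2) ℤ) *ᵥ v.toAdd := by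
  let F : SL(2, ℤ) →* MulAut (Multiplicative (Fin 2 → ℤ)) :=
    { toFun := fun B =>
        AddEquiv.toMultiplicative (Matrix.SpecialLinearGroup.toLin' B).toAddEquiv
      map_one' := by ext v i; simp
      map_mul' := by intro B C; ext v i; simp }
  have h : powAction A r = F (A ^ r.toAdd) := by
    rw [map_zpow]; rfl
  rw [h]
  exact Matrix.SpecialLinearGroup.toLin'_apply (A ^ r.toAdd) v.toAdd

/-- The semidirect product `ℤ² ⋊_A ℤ`. -/
abbrev SemidirectZ (A : SL(2, ℤ)) : Type :=
  Multiplicative (Fin 2 → ℤ) ⋊[powAction A] Multiplicative ℤ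

/-- The matrix `diag (e^s, e^{-s})`. -/
noncomputable def expDiag (s : ℝ) : Matrix (Fin 2) (Fin 2) ℝ :=
  !![Real.exp s, 0; 0, Real.exp (-s)]

/-- `P A P⁻¹ = diag (e^s, e^{-s})`. -/
def Diagonalizes (P : GL (Fin 2) ℝ) (A : SL(2, ℤ)) (s : ℝ) : Prop :=
  (P : Matrix (Fin 2) (Fin 2) ℝ) * (A : Matrix (Fin 2) (Fin 2) ℤ).map (Int.cast : ℤ → ℝ) *
    ((P⁻¹ : GL (Fin 2) ℝ) : Matrix (Fin 2) (Fin 2) ℝ) = expDiag s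

theorem expDiag_mul (s t : ℝ) : expDiag s * expDiag t = expDiag (s + t) := by
  ext i j; fin_cases i <;> fin_cases j <;>
    simp [expDiag, Matrix.mul_apply, Fin.sum_univ_two, Real.exp_add, mul_comm]

theorem expDiag_zero : expDiag 0 = 1 := by
  ext i j; fin_cases i <;> fin_cases j <;> simp [expDiag]

theorem Diagonalizes.zpow {P : GL (Fin 2) ℝ} {A : SL(2, ℤ)} {s : ℝ} (h : Diagonalizes P A s)
    (r : ℤ) : Diagonalizes P (A ^ r) (s * r) := by
  let D : Multiplicative ℝ →* Matrix (Fin 2) (Fin 2) ℝ :=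
    { toFun := fun t => expDiag t.toAdd
      map_one' := expDiag_zero
      map_mul' := fun a b => (expDiag_mul _ _).symm }
  let A' : GL (Fin 2) ℝ := (Matrix.SpecialLinearGroup.map (Int.castRingHom ℝ) A).toGL
  let D' : Multiplicative ℝ →* GL (Fin 2) ℝ := D.toHomUnits
  have h1 : P * A' * P⁻¹ = D' (Multiplicative.ofAdd s) := Units.ext h
  have h2 : P * A' ^ r * P⁻¹ = D' (Multiplicative.ofAdd (s * r)) := by
    rw [← conj_zpow, h1, ← map_zpow, ← ofAdd_zsmul, zsmul_eq_mul, mul_comm]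
  have h3 : A' ^ r = (Matrix.SpecialLinearGroup.map (Int.castRingHom ℝ) (A ^ r)).toGL := by
    rw [map_zpow, map_zpow]
  rw [h3] at h2
  exact congrArg Units.val h2

/-- The point `P (p, q)` of `ℝ²` attached to `v = (p, q) ∈ ℤ²`. -/
noncomputable def latticePoint (P : GL (Fin 2) ℝ) (v : Fin 2 → ℤ) : Fin 2 → ℝ :=
  (P : Matrix (Fin 2) (Fin 2) ℝ) *ᵥ fun i => (v i : ℝ)

theorem latticePoint_add (P : GL (Fin 2) ℝ) (v w : Fin 2 → ℤ) :
    latticePoint P (v + w) = latticePoint P v + latticePoint P w := by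
  simp only [latticePoint, ← Matrix.mulVec_add]
  congr 1; ext i; simp

theorem Diagonalizes.latticePoint_mulVec {P : GL (Fin 2) ℝ} {A : SL(2, ℤ)} {s : ℝ}
    (h : Diagonalizes P A s) (v : Fin 2 → ℤ) :
    latticePoint P ((A : Matrix (Fin 2) (Fin 2) ℤ) *ᵥ v) = expDiag s *ᵥ latticePoint P v := by
  have h1 : (fun i => ((((A : Matrix (Fin 2) (Fin 2) ℤ) *ᵥ v) i : ℤ) : ℝ)) =
      (A : Matrix (Fin 2) (Fin 2) ℤ).map (Int.cast : ℤ → ℝ) *ᵥ fun i => (v i : ℝ) := by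
    ext i; simp [Matrix.mulVec, dotProduct]
  have h2 : ((P⁻¹ : GL (Fin 2) ℝ) : Matrix (Fin 2) (Fin 2) ℝ) *
      (P : Matrix (Fin 2) (Fin 2) ℝ) = 1 := P.inv_mul
  rw [latticePoint, latticePoint, h1, ← show _ = expDiag s from h]
  simp only [Matrix.mulVec_mulVec, Matrix.mul_assoc, h2, Matrix.mul_one]

/-- The homomorphism `ℤ² ⋊_A ℤ → Sol`, `(p, q, r) ↦ (P (p, q), s r)`, for a matrix `P` with
`P A P⁻¹ = diag (e^s, e^{-s})`. -/
noncomputable def semidirectHom (A : SL(2, ℤ)) (P : GL (Fin 2) ℝ) (s : ℝ)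
    (h : Diagonalizes P A s) : SemidirectZ A →* Sol :=
  MonoidHom.mk'
    (fun g => ⟨latticePoint P g.left.toAdd 0, latticePoint P g.left.toAdd 1, s * g.right.toAdd⟩)
    (by
      intro a b
      have key : latticePoint P (a * b).left.toAdd = latticePoint P a.left.toAdd +
          expDiag (s * a.right.toAdd) *ᵥ latticePoint P b.left.toAdd := by
        rw [SemidirectProduct.mul_left, toAdd_mul, powAction_apply, latticePoint_add,
          (h.zpow _).latticePoint_mulVec]
      ext
      · simp only [key]; simp [expDiag, dotProduct, Fin.sum_univ_two]
      · simp only [key]; simp [expDiag, dotProduct, Fin.sum_univ_two]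
      · simp [mul_add])

/-! ### Finite invariant measures on quotients. -/

section Quotient

variable {G : Type*} [Group G] [TopologicalSpace G] [IsTopologicalGroup G] [MeasurableSpace G]
  [BorelSpace G]

/-! The finite measure enters only through Poincaré recurrence: no measurable function on the
quotient can rise by 1 under a translation (`IsLattice.false_of_shift`). Applied to `z`, this shows
that `Γ` leaves the plane `z = 0`; applied to a twisted `x`-coordinate, that `Γ ∩ ℝ²` is nontrivial.
The rest uses discreteness. Conjugation by `γ ∈ Γ` with `γ.z ≠ 0` acts hyperbolically on `Γ ∩ ℝ²`,
so no nonzero vector there lies on an axis. Hence such a vector and its image span the plane, `Γ ∩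
ℝ² = P ℤ²`, and the `z`-values of `Γ` form a cyclic group. A generator is made vertical by
conjugating with an element of `ℝ²`, which commutes with `P ℤ²`. -/

theorem measurable_const_smul_quotient (Γ : Subgroup G) (c : G) :
    Measurable fun q : G ⧸ Γ => c • q := by
  refine measurable_from_quotient.2 ?_
  exact measurable_from_quotient.1 measurable_id |>.comp (continuous_const_mul c).measurable

/-- A finite invariant measure rules out a measurable function on the quotient that some group
element shifts by `1`. -/
theorem IsLattice.false_of_shift {Γ : Subgroup G} (hΓ : IsLattice Γ) {f : G → ℝ}
    (hf : Measurable f) (hinv : ∀ g, ∀ γ ∈ Γ, f (g * γ) = f g) (c : G)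
    (hc : ∀ g, f (c * g) = f g + 1) : False := by
  obtain ⟨μ, h0, hfin, hμ⟩ := hΓ.finite_covolume
  let F : G ⧸ Γ → ℝ := Quotient.lift f (by
    intro a b hab
    have := hinv a _ (QuotientGroup.leftRel_apply.1 hab)
    simpa using this.symm)
  have hF : Measurable F := measurable_from_quotient.2 hf
  have hshift : ∀ q : G ⧸ Γ, F (c • q) = F q + 1 := by
    rintro ⟨g⟩
    exact hc g
  have hiter : ∀ (n : ℕ) (q : G ⧸ Γ), F ((fun q => c • q)^[n] q) = F q + n := by
    intro n q
    induction n with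
    | zero => simp
    | succ n ih => rw [Function.iterate_succ_apply', hshift, ih]; push_cast; ring
  have hpres : MeasurePreserving (fun q : G ⧸ Γ => c • q) μ μ :=
    ⟨measurable_const_smul_quotient Γ c, by
      ext s hs
      rw [Measure.map_apply (measurable_const_smul_quotient Γ c) hs,
        hμ.measure_preimage_smul c hs]⟩
  have hzero : ∀ k : ℤ, μ (F ⁻¹' Set.Ico (k : ℝ) (k + 1)) = 0 := by
    intro k
    by_contra hk
    -- Recurrence returns some point to the slab after `m ≥ 1` steps, but `F` has then grown by `m`
    -- and the slab has width 1.
    obtain ⟨q, hq, m, hm, hmq⟩ :=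
      hpres.conservative.exists_mem_iterate_mem (hF measurableSet_Ico).nullMeasurableSet hk
    rw [Set.mem_preimage, hiter] at hmq
    have : (1 : ℝ) ≤ m := by exact_mod_cast Nat.one_le_iff_ne_zero.2 hm
    have h1 := hmq.2
    have h2 := hq.1
    linarith
  refine h0 (Measure.measure_univ_eq_zero.1 ?_)
  have : (Set.univ : Set (G ⧸ Γ)) = ⋃ k : ℤ, F ⁻¹' Set.Ico (k : ℝ) (k + 1) := by
    refine (Set.eq_univ_of_forall fun q => Set.mem_iUnion.2 ⟨⌊F q⌋, ?_⟩).symm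
    exact ⟨Int.floor_le _, Int.lt_floor_add_one _⟩
  rw [this]
  exact measure_iUnion_null hzero

/-- The map `xΓ ↦ xg⁻¹(gΓg⁻¹)` commutes with left translation, so the measure can be pushed forward
along it. -/
theorem IsLattice.map_conj {Γ : Subgroup G} (hΓ : IsLattice Γ) (g : G) :
    IsLattice (Γ.map (MulAut.conj g).toMonoidHom) := by
  obtain ⟨μ, h0, hfin, hμ⟩ := hΓ.finite_covolume
  have hd := hΓ.discrete
  refine ⟨?_, ?_⟩
  · have hmem : ∀ x : Γ.map (MulAut.conj g).toMonoidHom, g⁻¹ * x * g ∈ Γ := by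
      rintro ⟨_, γ, hγ, rfl⟩
      simpa [mul_assoc] using hγ
    refine DiscreteTopology.of_continuous_injective
      (f := fun x : Γ.map (MulAut.conj g).toMonoidHom => (⟨g⁻¹ * x * g, hmem x⟩ : Γ)) ?_ ?_
    · fun_prop
    · intro a b hab
      simpa [Subtype.ext_iff] using hab
  · let φ : G ⧸ Γ → G ⧸ Γ.map (MulAut.conj g).toMonoidHom :=
      Quotient.lift (fun x => ((x * g⁻¹ : G) : G ⧸ Γ.map (MulAut.conj g).toMonoidHom)) (by
        intro a b hab
        refine QuotientGroup.eq.2 ⟨a⁻¹ * b, QuotientGroup.leftRel_apply.1 hab, ?_⟩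
        simp [mul_assoc])
    have hφ : Measurable φ := measurable_from_quotient.2
      (measurable_from_quotient.1 measurable_id |>.comp (continuous_mul_const g⁻¹).measurable)
    have hequiv : ∀ (c : G) (q : G ⧸ Γ), φ (c • q) = c • φ q := by
      rintro c ⟨x⟩
      change ((c * x * g⁻¹ : G) : G ⧸ Γ.map (MulAut.conj g).toMonoidHom) = ((c * (x * g⁻¹) : G) : _)
      rw [mul_assoc]
    refine ⟨μ.map φ, ?_, inferInstance, ⟨fun c s hs => ?_⟩⟩
    · rwa [Ne, Measure.map_eq_zero_iff hφ.aemeasurable]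
    · rw [Measure.map_apply hφ hs,
        Measure.map_apply hφ (measurable_const_smul_quotient _ c hs),
        ← hμ.measure_preimage_smul c (hφ hs)]
      congr 1
      ext q
      change c • φ q ∈ s ↔ φ (c • q) ∈ s
      rw [hequiv]

end Quotient

/-! ### The discrete group `Γ ∩ ℝ²` and the hyperbolic action on it. -/

namespace Sol

/-- The projection `Sol → ℝ`. -/
def zHom : Sol →* Multiplicative ℝ where
  toFun g := Multiplicative.ofAdd g.z
  map_one' := rfl
  map_mul' _ _ := rfl

theorem zpow_z (g : Sol) (n : ℤ) : (g ^ n).z = n * g.z := by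
  have h : (zHom (g ^ n)).toAdd = ((zHom g) ^ n).toAdd := by rw [map_zpow]
  simpa [zHom] using h

/-- The intersection of a subgroup of Sol with `ℝ²`. -/
def horizontal (Γ : Subgroup Sol) : Submodule ℤ (Fin 2 → ℝ) :=
  AddSubgroup.toIntSubmodule
    { carrier := {v | (⟨v 0, v 1, 0⟩ : Sol) ∈ Γ}
      zero_mem' := Γ.one_mem
      add_mem' := by
        intro v w hv hw
        have h := Γ.mul_mem hv hw
        have e : (⟨v 0, v 1, 0⟩ * ⟨w 0, w 1, 0⟩ : Sol) = ⟨(v + w) 0, (v + w) 1, 0⟩ := by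
          ext <;> simp
        rwa [e] at h
      neg_mem' := by
        intro v hv
        have h := Γ.inv_mem hv
        have e : (⟨v 0, v 1, 0⟩⁻¹ : Sol) = ⟨(-v) 0, (-v) 1, 0⟩ := by
          ext <;> simp
        rwa [e] at h }

theorem mem_horizontal {Γ : Subgroup Sol} {v : Fin 2 → ℝ} :
    v ∈ horizontal Γ ↔ (⟨v 0, v 1, 0⟩ : Sol) ∈ Γ := Iff.rfl

theorem mem_horizontal_of_z_eq_zero {Γ : Subgroup Sol} {γ : Sol} (hγ : γ ∈ Γ) (hz : γ.z = 0) :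
    ![γ.x, γ.y] ∈ horizontal Γ := by
  have e : (⟨γ.x, γ.y, 0⟩ : Sol) = γ := by ext <;> simp [hz]
  simpa [mem_horizontal, e] using hγ

theorem expDiag_mulVec (s : ℝ) (v : Fin 2 → ℝ) :
    expDiag s *ᵥ v = ![Real.exp s * v 0, Real.exp (-s) * v 1] := by
  ext i; fin_cases i <;> simp [expDiag, Matrix.mulVec, dotProduct, Fin.sum_univ_two]

theorem expDiag_mulVec_mem_horizontal {Γ : Subgroup Sol} {γ : Sol} (hγ : γ ∈ Γ)
    {v : Fin 2 → ℝ} (hv : v ∈ horizontal Γ) : expDiag γ.z *ᵥ v ∈ horizontal Γ := by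
  have h := Γ.mul_mem (Γ.mul_mem hγ hv) (Γ.inv_mem hγ)
  have e : γ * ⟨v 0, v 1, 0⟩ * γ⁻¹ = ⟨Real.exp γ.z * v 0, Real.exp (-γ.z) * v 1, 0⟩ := by
    ext <;> simp [Real.exp_neg]
  rw [e] at h
  rw [expDiag_mulVec]
  exact h

section Discrete

variable {Γ : Subgroup Sol} [DiscreteTopology Γ]

theorem exists_isolated (Γ : Subgroup Sol) [DiscreteTopology Γ] :
    ∃ ε > 0, ∀ γ ∈ Γ, |γ.x| < ε → |γ.y| < ε → |γ.z| < ε → γ = 1 := by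
  obtain ⟨U, hU, hUΓ⟩ := isOpen_induced_iff.1 (isOpen_discrete ({1} : Set Γ))
  have h1 : (1 : Sol) ∈ U := by
    have : (1 : Γ) ∈ Subtype.val ⁻¹' U := by rw [hUΓ]; rfl
    exact this
  obtain ⟨ε, hε, hball⟩ := Metric.isOpen_iff.1 (hU.preimage homeomorphProd.symm.continuous)
    (0 : ℝ × ℝ × ℝ) h1
  refine ⟨ε, hε, fun γ hγ hx hy hz => ?_⟩
  have hmem : (γ.x, γ.y, γ.z) ∈ Metric.ball (0 : ℝ × ℝ × ℝ) ε := by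
    simp [Prod.norm_def, hx, hy, hz]
  have hγU : γ ∈ U := hball hmem
  have : (⟨γ, hγ⟩ : Γ) ∈ ({1} : Set Γ) := by rw [← hUΓ]; exact hγU
  exact congrArg Subtype.val this

theorem horizontal_isolated (Γ : Subgroup Sol) [DiscreteTopology Γ] :
    ∃ ε > 0, ∀ v ∈ horizontal Γ, |v 0| < ε → |v 1| < ε → v = 0 := by
  obtain ⟨ε, hε, h⟩ := exists_isolated Γ
  refine ⟨ε, hε, fun v hv h0 h1 => ?_⟩
  have e := h _ (mem_horizontal.1 hv) h0 h1 (by simpa using hε)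
  ext i; fin_cases i
  · exact congrArg Sol.x e
  · exact congrArg Sol.y e

instance discreteTopology_horizontal : DiscreteTopology (horizontal Γ) := by
  refine DiscreteTopology.of_continuous_injective
    (f := fun v : horizontal Γ => (⟨⟨v.1 0, v.1 1, 0⟩, v.2⟩ : Γ)) ?_ ?_
  · exact (continuous_mk ((continuous_apply 0).comp continuous_subtype_val)
      ((continuous_apply 1).comp continuous_subtype_val) continuous_const).subtype_mk _
  · intro v w h
    have h' := congrArg Subtype.val h
    ext i; fin_cases i
    · exact congrArg Sol.x h'
    · exact congrArg Sol.y h'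

theorem exists_exp_mul_lt {s : ℝ} (hs : s ≠ 0) (a : ℝ) {ε : ℝ} (hε : 0 < ε) :
    ∃ n : ℤ, |Real.exp (n * s) * a| < ε := by
  obtain ⟨n, hn⟩ : ∃ n : ℕ, Real.exp (-|s|) ^ n < ε / (|a| + 1) :=
    exists_pow_lt_of_lt_one (by positivity) (by simpa using hs)
  rw [← Real.exp_nat_mul, lt_div_iff₀ (by positivity)] at hn
  have key : |Real.exp (n * -|s|) * a| < ε := by
    rw [abs_mul, Real.abs_exp]
    nlinarith [Real.exp_pos (n * -|s|)]
  rcases abs_cases s with ⟨h, -⟩ | ⟨h, -⟩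
  · exact ⟨-n, by rw [h] at key; simpa using key⟩
  · exact ⟨n, by rw [h] at key; simpa using key⟩

/-- On either axis, suitable powers of `γ` contract a vector to arbitrarily small size, against
discreteness. -/
theorem coord_ne_zero_of_mem_horizontal {γ : Sol} (hγ : γ ∈ Γ) (hz : γ.z ≠ 0)
    {v : Fin 2 → ℝ} (hv : v ∈ horizontal Γ) (hv0 : v ≠ 0) : v 0 ≠ 0 ∧ v 1 ≠ 0 := by
  obtain ⟨ε, hε, h⟩ := horizontal_isolated Γ
  have hmem : ∀ n : ℤ, ![Real.exp (n * γ.z) * v 0, Real.exp (-(n * γ.z)) * v 1] ∈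
      horizontal Γ := by
    intro n
    have := expDiag_mulVec_mem_horizontal (Γ.zpow_mem hγ n) hv
    rwa [zpow_z, expDiag_mulVec] at this
  refine ⟨fun h0 => hv0 ?_, fun h1 => hv0 ?_⟩
  · obtain ⟨n, hn⟩ := exists_exp_mul_lt (neg_ne_zero.2 hz) (v 1) hε
    have e := congrFun (h _ (hmem n) (by simpa [h0] using hε) (by simpa using hn)) 1
    ext i; fin_cases i
    · exact h0
    · simpa using e
  · obtain ⟨n, hn⟩ := exists_exp_mul_lt hz (v 0) hε
    have e := congrFun (h _ (hmem n) (by simpa using hn) (by simpa [h1] using hε)) 0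
    ext i; fin_cases i
    · simpa using e
    · exact h1

theorem isZLattice_horizontal {γ : Sol} (hγ : γ ∈ Γ) (hz : γ.z ≠ 0)
    (hΓ : horizontal Γ ≠ ⊥) : IsZLattice ℝ (horizontal Γ) := by
  obtain ⟨v, hv, hv0⟩ := (Submodule.ne_bot_iff _).1 hΓ
  obtain ⟨h0, h1⟩ := coord_ne_zero_of_mem_horizontal hγ hz hv hv0
  have hw := expDiag_mulVec_mem_horizontal hγ hv
  refine ⟨eq_top_iff.2 fun u _ => ?_⟩
  have hne : Real.exp (-γ.z) - Real.exp γ.z ≠ 0 := by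
    rw [sub_ne_zero, Ne, Real.exp_eq_exp]
    intro h
    exact hz (by linarith)
  set a := Real.exp γ.z
  set b := Real.exp (-γ.z)
  -- The coefficients come from Cramer's rule for the basis `v`, `expDiag γ.z *ᵥ v`.
  have hu : u = ((b * u 0 / v 0 - a * u 1 / v 1) / (b - a)) • v +
      ((u 1 / v 1 - u 0 / v 0) / (b - a)) • (expDiag γ.z *ᵥ v) := by
    rw [expDiag_mulVec]
    ext i; fin_cases i
    · simp; field_simp; ring
    · simp; field_simp; ring
  rw [hu]
  exact add_mem (Submodule.smul_mem _ _ (Submodule.subset_span hv))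
    (Submodule.smul_mem _ _ (Submodule.subset_span hw))

/-- If `δ.z` is small, then `expDiag δ.z *ᵥ v - v` is a short vector of `Γ ∩ ℝ²`, hence zero, which
forces `δ.z = 0`. So the `z`-values have 0 isolated. -/
theorem exists_z_generator {γ : Sol} (hγ : γ ∈ Γ) (hz : γ.z ≠ 0) (hΓ : horizontal Γ ≠ ⊥) :
    ∃ γ₀ ∈ Γ, γ₀.z ≠ 0 ∧ ∀ δ ∈ Γ, ∃ n : ℤ, δ.z = n * γ₀.z := by
  obtain ⟨v, hv, hv0⟩ := (Submodule.ne_bot_iff _).1 hΓ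
  obtain ⟨h0, -⟩ := coord_ne_zero_of_mem_horizontal hγ hz hv hv0
  obtain ⟨ε, hε, h⟩ := horizontal_isolated Γ
  have hc0 : ∀ᶠ t in nhds (0 : ℝ), |Real.exp t * v 0 - v 0| < ε := by
    have : ContinuousAt (fun t : ℝ => |Real.exp t * v 0 - v 0|) 0 := by fun_prop
    exact this.eventually_lt continuousAt_const (by simpa using hε)
  have hc1 : ∀ᶠ t in nhds (0 : ℝ), |Real.exp (-t) * v 1 - v 1| < ε := by
    have : ContinuousAt (fun t : ℝ => |Real.exp (-t) * v 1 - v 1|) 0 := by fun_prop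
    exact this.eventually_lt continuousAt_const (by simpa using hε)
  obtain ⟨a, ha, hball⟩ := Metric.eventually_nhds_iff.1 (hc0.and hc1)
  let H : AddSubgroup ℝ := Subgroup.toAddSubgroup' (Γ.map zHom)
  have hH : ∀ t, t ∈ H ↔ ∃ δ ∈ Γ, δ.z = t := fun t => Iff.rfl
  obtain ⟨s, hs⟩ := AddSubgroup.cyclic_of_isolated_zero (H := H) ha (by
    rw [Set.disjoint_left]
    rintro t ht ⟨ht0, hta⟩
    obtain ⟨δ, hδ, rfl⟩ := (hH t).1 ht
    obtain ⟨e0, e1⟩ := hball (y := δ.z) (by simpa [abs_of_pos ht0] using hta)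
    have hm := sub_mem (expDiag_mulVec_mem_horizontal hδ hv) hv
    rw [expDiag_mulVec] at hm
    have e := congrFun (h _ hm (by simpa using e0) (by simpa using e1)) 0
    have e' : (Real.exp δ.z - 1) * v 0 = 0 := by
      simpa [sub_mul] using e
    rcases mul_eq_zero.1 e' with e' | e'
    · rw [sub_eq_zero, Real.exp_eq_one_iff] at e'
      exact ht0.ne' e'
    · exact h0 e')
  have hgen : ∀ t, t ∈ H ↔ ∃ n : ℤ, n * s = t := by
    intro t
    simp [hs, AddSubgroup.mem_closure_singleton]
  obtain ⟨γ₀, hγ₀, rfl⟩ := (hH s).1 ((hgen s).2 ⟨1, by simp⟩)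
  have hall : ∀ δ ∈ Γ, ∃ n : ℤ, δ.z = n * γ₀.z := by
    intro δ hδ
    obtain ⟨n, hn⟩ := (hgen _).1 ((hH _).2 ⟨δ, hδ, rfl⟩)
    exact ⟨n, hn.symm⟩
  refine ⟨γ₀, hγ₀, fun h0 => hz ?_, hall⟩
  obtain ⟨n, hn⟩ := hall γ hγ
  simpa [h0] using hn

end Discrete

/-! ### Consequences of finite covolume. -/

section Lattice

variable {Γ : Subgroup Sol}

theorem exists_z_ne_zero (hΓ : IsLattice Γ) : ∃ γ ∈ Γ, γ.z ≠ 0 := by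
  by_contra! h
  exact hΓ.false_of_shift continuous_z.measurable (fun g γ hγ => by simp [h γ hγ])
    ⟨0, 0, 1⟩ (fun g => by simp [add_comm])

/-- Commutators have `z = 0`, so a trivial `Γ ∩ ℝ²` makes all of `Γ` commute with `γ`. Then `Γ`,
acting on the `x`-line by `t ↦ δ.x + e^{δ.z} t`, fixes the fixed point of `γ`. -/
theorem horizontal_ne_bot (hΓ : IsLattice Γ) : horizontal Γ ≠ ⊥ := by
  intro hbot
  obtain ⟨γ, hγ, hz⟩ := exists_z_ne_zero hΓ
  have hinj : ∀ δ ∈ Γ, δ.z = 0 → δ.x = 0 := by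
    intro δ hδ h
    have := mem_horizontal_of_z_eq_zero hδ h
    rw [hbot, Submodule.mem_bot] at this
    simpa using congrFun this 0
  have hne : 1 - Real.exp γ.z ≠ 0 := by
    rw [sub_ne_zero, Ne, eq_comm, Real.exp_eq_one_iff]
    exact hz
  -- This `f` is the image under `g` of the fixed point of `γ`; it is right `Γ`-invariant and rises
  -- by 1 under `⟨1, 0, 0⟩`.
  refine hΓ.false_of_shift (f := fun g => g.x + Real.exp g.z * (γ.x / (1 - Real.exp γ.z)))
    (continuous_x.add ((Real.continuous_exp.comp continuous_z).mul
      continuous_const)).measurable (fun g δ hδ => ?_) ⟨1, 0, 0⟩ (fun g => by simp; ring)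
  have hcomm := hinj (δ * γ * δ⁻¹ * γ⁻¹)
    (Γ.mul_mem (Γ.mul_mem (Γ.mul_mem hδ hγ) (Γ.inv_mem hδ)) (Γ.inv_mem hγ)) (by simp)
  have hfix : δ.x * (1 - Real.exp γ.z) + Real.exp δ.z * γ.x = γ.x := by
    simp only [mul_x, mul_z, inv_x, inv_z, Real.exp_add, Real.exp_neg] at hcomm
    field_simp at hcomm
    linarith
  simp only [mul_x, mul_z, Real.exp_add]
  field_simp
  linear_combination Real.exp g.z * hfix

end Lattice

/-! ### Normal form of `Γ`. -/

/-- A lattice of `ℝ²` stable under `diag (e^s, e^{-s})` is `P ℤ²` for some `P` that conjugates an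
element of `SL₂(ℤ)` to `diag (e^s, e^{-s})`. -/
theorem exists_diagonalizes (L : Submodule ℤ (Fin 2 → ℝ)) [DiscreteTopology L] [IsZLattice ℝ L]
    (s : ℝ) (hL : ∀ v ∈ L, expDiag s *ᵥ v ∈ L) :
    ∃ (A : SL(2, ℤ)) (P : GL (Fin 2) ℝ), Diagonalizes P A s ∧ Set.range (latticePoint P) = L := by
  have := ZLattice.module_finite ℝ L
  have := ZLattice.module_free ℝ L
  let b : Module.Basis (Fin 2) ℤ L := Module.finBasisOfFinrankEq ℤ L (by
    rw [ZLattice.rank ℝ L]; simp)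
  let M : Matrix (Fin 2) (Fin 2) ℝ := Matrix.of fun i j => (b j : Fin 2 → ℝ) i
  have hM : IsUnit M := by
    rw [← Matrix.linearIndependent_cols_iff_isUnit]
    have hcol : M.col = b.ofZLatticeBasis ℝ L := by
      ext j i
      simp [M]
    rw [hcol]
    exact (b.ofZLatticeBasis ℝ L).linearIndependent
  have hMv : ∀ v : Fin 2 → ℤ, (M *ᵥ fun i => (v i : ℝ)) = (b.equivFun.symm v : L) := by
    intro v
    ext i
    simp [M, Matrix.mulVec, dotProduct, Fin.sum_univ_two, Module.Basis.equivFun_symm_apply,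
      mul_comm]
  -- `B` is the matrix of `expDiag s` in the basis `b`; stability of `L` makes it integral.
  let B : Matrix (Fin 2) (Fin 2) ℤ :=
    Matrix.of fun i j => b.equivFun ⟨expDiag s *ᵥ (b j : Fin 2 → ℝ), hL _ (b j).2⟩ i
  have hMB : M * B.map (Int.cast : ℤ → ℝ) = expDiag s * M := by
    ext i j
    have h := congrFun (hMv (b.equivFun ⟨expDiag s *ᵥ (b j : Fin 2 → ℝ), hL _ (b j).2⟩)) i
    rw [LinearEquiv.symm_apply_apply] at h
    exact h
  have hdetM : M.det ≠ 0 := ((Matrix.isUnit_iff_isUnit_det M).1 hM).ne_zero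
  have hB : B.det = 1 := by
    have h := congrArg Matrix.det hMB
    have hD : (expDiag s).det = 1 := by simp [expDiag, Matrix.det_fin_two, ← Real.exp_add]
    have hc : (B.map (Int.cast : ℤ → ℝ)).det = (B.det : ℝ) := (Int.cast_det B).symm
    rw [Matrix.det_mul, Matrix.det_mul, hD, one_mul, hc] at h
    exact_mod_cast mul_left_cancel₀ hdetM (h.trans (mul_one _).symm)
  refine ⟨⟨B, hB⟩, hM.unit, ?_, ?_⟩
  · change M * B.map (Int.cast : ℤ → ℝ) * _ = expDiag s
    rw [hMB, mul_assoc]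
    have h1 : M * ((hM.unit⁻¹ : GL (Fin 2) ℝ) : Matrix (Fin 2) (Fin 2) ℝ) = 1 :=
      hM.unit.mul_inv
    rw [h1, mul_one]
  · ext w
    constructor
    · rintro ⟨v, rfl⟩
      change (M *ᵥ fun i => (v i : ℝ)) ∈ L
      rw [hMv]
      exact (b.equivFun.symm v).2
    · intro hw
      refine ⟨b.equivFun ⟨w, hw⟩, ?_⟩
      change (M *ᵥ fun i => ((b.equivFun ⟨w, hw⟩) i : ℝ)) = w
      rw [hMv, LinearEquiv.symm_apply_apply]

theorem latticePoint_injective (P : GL (Fin 2) ℝ) : Function.Injective (latticePoint P) := by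
  intro v w h
  have h' := Matrix.mulVec_injective_of_isUnit P.isUnit h
  ext i
  exact_mod_cast congrFun h' i

theorem semidirectHom_injective {A : SL(2, ℤ)} {P : GL (Fin 2) ℝ} {s : ℝ}
    (h : Diagonalizes P A s) (hs : s ≠ 0) : Function.Injective (semidirectHom A P s h) := by
  intro a b hab
  have hx : latticePoint P a.left.toAdd 0 = latticePoint P b.left.toAdd 0 := congrArg Sol.x hab
  have hy : latticePoint P a.left.toAdd 1 = latticePoint P b.left.toAdd 1 := congrArg Sol.y hab
  have hz : s * (a.right.toAdd : ℝ) = s * (b.right.toAdd : ℝ) := congrArg Sol.z hab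
  refine SemidirectProduct.ext ?_ ?_
  · refine latticePoint_injective P ?_
    ext i; fin_cases i
    · exact hx
    · exact hy
  · have := mul_left_cancel₀ hs hz
    exact_mod_cast this

/-- An element of Sol with nonzero `z` is conjugate to its `z`-part by an element of `ℝ²`. -/
theorem exists_conj_eq (γ : Sol) (hz : γ.z ≠ 0) :
    ∃ g : Sol, g.z = 0 ∧ g * ⟨0, 0, γ.z⟩ * g⁻¹ = γ := by
  have h0 : 1 - Real.exp γ.z ≠ 0 := by
    rw [sub_ne_zero, Ne, eq_comm, Real.exp_eq_one_iff]
    exact hz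
  have h1 : 1 - Real.exp (-γ.z) ≠ 0 := by
    rw [sub_ne_zero, Ne, eq_comm, Real.exp_eq_one_iff]
    exact neg_ne_zero.2 hz
  -- The coordinates are the fixed points of the affine actions of `γ` on the `x`- and `y`-lines.
  refine ⟨⟨γ.x / (1 - Real.exp γ.z), γ.y / (1 - Real.exp (-γ.z)), 0⟩, rfl, ?_⟩
  rw [mul_inv_eq_iff_eq_mul]
  ext
  · simp; field_simp; ring
  · simp; field_simp; ring
  · simp

theorem vertical_zpow (s : ℝ) (n : ℤ) : (⟨0, 0, s⟩ : Sol) ^ n = ⟨0, 0, s * n⟩ := by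
  let F : Multiplicative ℝ →* Sol :=
    { toFun := fun t => ⟨0, 0, t.toAdd⟩
      map_one' := rfl
      map_mul' := fun a b => by ext <;> simp }
  have h := map_zpow F (Multiplicative.ofAdd s) n
  rw [← ofAdd_zsmul, zsmul_eq_mul, mul_comm] at h
  exact h.symm

theorem conj_horizontal {g : Sol} (hg : g.z = 0) (a b : ℝ) :
    g * ⟨a, b, 0⟩ * g⁻¹ = ⟨a, b, 0⟩ := by
  ext <;> simp [hg]

/-- If `Γ ∩ ℝ² = P ℤ²` and `γ ∈ Γ` generates `Γ` modulo `ℝ²`, then `Γ` is a conjugate of the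
semidirect product `P ℤ² ⋊ γ.z ℤ`. -/
theorem map_conj_range_semidirectHom {Γ : Subgroup Sol} {A : SL(2, ℤ)} {P : GL (Fin 2) ℝ}
    {γ g : Sol} (h : Diagonalizes P A γ.z) (hP : Set.range (latticePoint P) = horizontal Γ)
    (hγ : γ ∈ Γ) (hgen : ∀ δ ∈ Γ, ∃ n : ℤ, δ.z = n * γ.z)
    (hg : g.z = 0) (hconj : g * ⟨0, 0, γ.z⟩ * g⁻¹ = γ) :
    (semidirectHom A P γ.z h).range.map (MulAut.conj g).toMonoidHom = Γ := by
  have key : ∀ a : SemidirectZ A, MulAut.conj g (semidirectHom A P γ.z h a) =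
      ⟨latticePoint P a.left.toAdd 0, latticePoint P a.left.toAdd 1, 0⟩ *
        γ ^ a.right.toAdd := by
    intro a
    have hsplit : semidirectHom A P γ.z h a =
        ⟨latticePoint P a.left.toAdd 0, latticePoint P a.left.toAdd 1, 0⟩ *
          (⟨0, 0, γ.z⟩ : Sol) ^ a.right.toAdd := by
      rw [vertical_zpow]
      ext <;> simp [semidirectHom]
    rw [hsplit, map_mul, map_zpow, MulAut.conj_apply, MulAut.conj_apply, hconj,
      conj_horizontal hg]
  ext δ
  constructor
  · rintro ⟨_, ⟨a, rfl⟩, rfl⟩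
    have hmem : latticePoint P a.left.toAdd ∈ (horizontal Γ : Set (Fin 2 → ℝ)) :=
      hP ▸ Set.mem_range_self _
    change MulAut.conj g (semidirectHom A P γ.z h a) ∈ Γ
    rw [key]
    exact Γ.mul_mem hmem (Γ.zpow_mem hγ _)
  · intro hδ
    obtain ⟨n, hn⟩ := hgen δ hδ
    have hz : (δ * (γ ^ n)⁻¹).z = 0 := by simp [zpow_z, hn]
    have hmem : ![(δ * (γ ^ n)⁻¹).x, (δ * (γ ^ n)⁻¹).y] ∈ (horizontal Γ : Set (Fin 2 → ℝ)) :=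
      mem_horizontal_of_z_eq_zero (Γ.mul_mem hδ (Γ.inv_mem (Γ.zpow_mem hγ n))) hz
    rw [← hP] at hmem
    obtain ⟨v, hv⟩ := hmem
    refine ⟨_, ⟨⟨Multiplicative.ofAdd v, Multiplicative.ofAdd n⟩, rfl⟩, ?_⟩
    refine (key _).trans (mul_inv_eq_iff_eq_mul.1 ?_).symm
    ext
    · exact (congrFun hv 0).symm
    · exact (congrFun hv 1).symm
    · exact hz

end Sol

theorem mainTheorem3 (Γ : Subgroup Sol) (hΓ : IsLattice Γ) :
    ∃ (A : SL(2, ℤ)) (P : GL (Fin 2) ℝ) (s : ℝ) (h : Diagonalizes P A s) (g : Sol),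
      s ≠ 0 ∧
      Function.Injective (semidirectHom A P s h) ∧
      IsLattice (semidirectHom A P s h).range ∧
      (semidirectHom A P s h).range.map (MulAut.conj g).toMonoidHom = Γ := by
  have := hΓ.discrete
  have hbot := Sol.horizontal_ne_bot hΓ
  obtain ⟨γ', hγ', hz'⟩ := Sol.exists_z_ne_zero hΓ
  obtain ⟨γ, hγ, hz, hgen⟩ := Sol.exists_z_generator hγ' hz' hbot
  have := Sol.isZLattice_horizontal hγ hz hbot
  obtain ⟨A, P, h, hP⟩ := Sol.exists_diagonalizes (Sol.horizontal Γ) γ.z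
    fun v hv => Sol.expDiag_mulVec_mem_horizontal hγ hv
  obtain ⟨g, hg, hconj⟩ := Sol.exists_conj_eq γ hz
  have hmap := Sol.map_conj_range_semidirectHom h hP hγ hgen hg hconj
  refine ⟨A, P, γ.z, h, g, hz, Sol.semidirectHom_injective h hz, ?_, hmap⟩
  -- The semidirect product is `g⁻¹Γg`, so it inherits the lattice property from `Γ`.
  have hrange : Γ.map (MulAut.conj g⁻¹).toMonoidHom = (semidirectHom A P γ.z h).range := by
    rw [← hmap, Subgroup.map_map]
    convert Subgroup.map_id _
    ext1 x
    simp [mul_assoc]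
  rw [← hrange]
  exact hΓ.map_conj g⁻¹
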